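/- **First-Order Composite Channel.** Let $\mathcal H$ be a finite-dimensional complex Hilbert space (for instance of dimension $2^n$), and let $H=A+B$ with $A=\sum_{i=1}^{L_A}a_iA_i$ and $B=\sum_{j=1}^{L_B}b_jB_j$, where $a_i,b_j\ge 0$, all $A_i,B_j$ are Hermitian operators on $\mathcal H$ of spectral norm $1$, and $\lambda_B=\sum_j b_j>0$. Write $\|\cdot\|$ for the spectral norm and $\|\Phi\|_\diamond=\sup_{k}\sup_{\|X\|_1\le 1}\|(\Phi\otimes \mathrm{id}_k)(X)\|_1$ for the diamond norm. For real $t$ put $\mathcal U(t):\rho\mapsto e^{iHt}\rho e^{-iHt}$; let $\widetilde{\mathcal U}_A(t)$ be the first-order Trotter channel $\rho\mapsto S(t)\rho S(t)^\dagger$ with $S(t)=e^{ia_{L_A}A_{L_A}t}\cdots e^{ia_1A_1t}$; let $\mathcal U_{QD}(t):\rho\mapsto\sum_j \frac{b_j}{\lambda_B}e^{iB_j\lambda_B t}\rho e^{-iB_j\lambda_B t}$ be a single QDrift sample, and for an integer $N_B\ge 1$ let $\widetilde{\mathcal U}_B(t)=\mathcal U_{QD}(t/N_B)^{\circ N_B}$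 be the QDrift channel with $N_B$ samples. Let $\widetilde{\mathcal U}(t)=\widetilde{\mathcal U}_B(t)\circ\widetilde{\mathcal U}_A(t)$. Let $t\in\mathbb R$, $\epsilon>0$, and $$r=\left\lceil\frac{t^2}{\epsilon}\left(\sum_{i,j}a_ia_j\|[A_i,A_j]\|+\sum_{i,j}a_ib_j\|[A_i,B_j]\|+\frac{4\lambda_B^2}{N_B}\right)\right\rceil .$$ Then $$\left\|\mathcal U(t)-\widetilde{\mathcal U}(t/r)^{\circ r}\right\|_\diamond<\epsilon ,$$ and $\widetilde{\mathcal U}(t/r)^{\circ r}$ is implemented by a randomized sequence of gates of the form $e^{iA_it'}$, $e^{iB_jt'}$ ($t'\in\mathbb R$) which in every run consists of exactly $(L_A+N_B)\,r$ gates. (If $t=0$, then $r=0$ and $\widetilde{\mathcal U}(t/r)^{\circ r}$ is the identity.) -/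

import Mathlib

open scoped Matrix Matrix.Norms.L2Operator ENNReal

noncomputable section

namespace CompositeSim

/-- A Hamiltonian given as a weighted list of terms `∑ i, h i • H i`: the weights `h i` are
nonnegative and the terms `H i` are Hermitian matrices of spectral norm one.
(The norm on matrices is the spectral norm, from `Matrix.Norms.L2Operator`.) -/
structure Hamiltonian (d : Type*) [Fintype d] [DecidableEq d] where
  /-- number of terms -/
  L : ℕ
  /-- weights -/
  h : Fin L → ℝ
  /-- normalized terms -/
  H : Fin L → Matrix d d ℂ
  h_nonneg : ∀ i, 0 ≤ h i
  isHermitian : ∀ i, (H i).IsHermitian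
  norm_eq_one : ∀ i, ‖H i‖ = 1

/-- Linear maps on `d × d` complex matrices; quantum channels are among these. -/
abbrev SuperOp (d : Type*) : Type _ := Module.End ℂ (Matrix d d ℂ)

section

variable {d : Type*} [Fintype d] [DecidableEq d]

/-- The operator `∑ i, h i • H i`. -/
def Hamiltonian.op (A : Hamiltonian d) : Matrix d d ℂ := ∑ i, (A.h i : ℂ) • A.H i

/-- The sum of the weights, `λ = ∑ i, h i`. -/
def Hamiltonian.lam (A : Hamiltonian d) : ℝ := ∑ i, A.h i

/-- `e^{i M t}`. -/
def expI (M : Matrix d d ℂ) (t : ℝ) : Matrix d d ℂ :=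
  NormedSpace.exp ((Complex.I * (t : ℂ)) • M)

/-- The map `ρ ↦ U ρ U†`. -/
def conjBy (U : Matrix d d ℂ) : SuperOp d where
  toFun ρ := U * ρ * Uᴴ
  map_add' ρ σ := by rw [Matrix.mul_add, Matrix.add_mul]
  map_smul' c ρ := by simp

/-- The ideal evolution `ρ ↦ e^{i M t} ρ e^{-i M t}` generated by a Hermitian matrix `M`. -/
def idealChannel (M : Matrix d d ℂ) (t : ℝ) : SuperOp d := conjBy (expI M t)

/-- The first-order Trotter operator `e^{i h_L H_L t} ⋯ e^{i h_1 H_1 t}`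
(the first term is the rightmost factor). -/
def trotterUnitary (A : Hamiltonian d) (t : ℝ) : Matrix d d ℂ :=
  (List.ofFn fun i => expI (A.H i) (A.h i * t)).reverse.prod

/-- The first-order Trotter channel. -/
def trotterChannel (A : Hamiltonian d) (t : ℝ) : SuperOp d := conjBy (trotterUnitary A t)

/-- A single QDrift sample:
`ρ ↦ ∑ i, (h i / λ) e^{i H_i λ t} ρ e^{-i H_i λ t}`. -/
def qdriftSample (B : Hamiltonian d) (t : ℝ) : SuperOp d :=
  ∑ i, ((B.h i / B.lam : ℝ) : ℂ) • conjBy (expI (B.H i) (B.lam * t))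

/-- The QDrift channel for time `t` with `N` independent samples. -/
def qdriftChannel (B : Hamiltonian d) (N : ℕ) (t : ℝ) : SuperOp d :=
  qdriftSample B (t / N) ^ N

/-- The first-order composite channel: Trotter on `A`, followed by QDrift on `B`. -/
def compositeChannel (A B : Hamiltonian d) (N : ℕ) (t : ℝ) : SuperOp d :=
  qdriftChannel B N t ∘ₗ trotterChannel A t

/-- The trace norm: the sum of the singular values, i.e. of the square roots of the
eigenvalues of `X† X`. -/
def traceNorm (X : Matrix d d ℂ) : ℝ :=
  ∑ i, √((Matrix.isHermitian_conjTranspose_mul_self X).eigenvalues i)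

/-- `Φ ⊗ id` on `d ⊗ k`: apply `Φ` to each `d × d` block. -/
def ampliate (k : ℕ) (Φ : SuperOp d) (X : Matrix (d × Fin k) (d × Fin k) ℂ) :
    Matrix (d × Fin k) (d × Fin k) ℂ :=
  Matrix.of fun p q => Φ (Matrix.of fun i j => X (i, p.2) (j, q.2)) p.1 q.1

/-- The diamond norm `sup_k ‖Φ ⊗ id_k‖₁`, where the inner norm is induced by the trace norm. -/
def diamondNorm (Φ : SuperOp d) : ℝ≥0∞ :=
  ⨆ (k : ℕ) (X : Matrix (d × Fin k) (d × Fin k) ℂ) (_ : traceNorm X ≤ 1),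
    ENNReal.ofReal (traceNorm (ampliate k Φ X))

/-- The unitary of a sequence of gates: `(i, t')` stands for the gate `e^{i K_i t'}`, and the
last gate of the list is applied first. -/
def gateProduct {κ : Type} (K : κ → Matrix d d ℂ) (l : List (κ × ℝ)) : Matrix d d ℂ :=
  (l.map fun g => expI (K g.1) g.2).prod

end

/-- A randomized sequence of exponential gates whose generators are labelled by `κ`: with
probability `prob k` the gate sequence `gates k` is applied. -/
structure RandomCircuit (κ : Type) where
  /-- number of possible outcomes of the randomness -/
  m : ℕ
  prob : Fin m → ℝ
  gates : Fin m → List (κ × ℝ)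
  prob_nonneg : ∀ k, 0 ≤ prob k
  sum_prob : ∑ k, prob k = 1

/-- The channel implemented by a randomized gate sequence. -/
def RandomCircuit.channel {d : Type*} [Fintype d] [DecidableEq d] {κ : Type}
    (C : RandomCircuit κ) (K : κ → Matrix d d ℂ) : SuperOp d :=
  ∑ k, ((C.prob k : ℝ) : ℂ) • conjBy (gateProduct K (C.gates k))

end CompositeSim

end

/-! Up to a factor 2, the diamond distance of two unitary channels is bounded by the operator
distance of the unitaries. Hence replacing `e^{iHs}` by `e^{iBs} S(s)` costs at most `s²` times the
two commutator sums: `norm_exp_add_sub_exp_mul_exp_le` splits off `B`, and induction over the terms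
of `A` does the rest.

QDrift must be compared as a channel. With `E = U - 1`, the map `ρ ↦ UρU†` is the identity plus `Eρ
+ ρE†` plus `EρE†`. Averaged over the samples, the first-order parts agree with those of `e^{iBs}`.
What remains is second order: four terms of size `(λ_B s)²`, one of them strictly smaller. Using
`N_B` samples of duration `s/N_B` gives `4λ_B²s²/N_B`.

All errors are carried by `DiamondLE`, a bound for every ampliation, which is additive and
submultiplicative; this rests on the duality of trace norm and spectral norm. Telescoping over `r`
steps with `s = t/r` gives an error below `t²Γ/r ≤ ε`, where `Γ` is the bracket in the definition of
`r`. Gate counts follow because independent random circuits compose with product probabilities. -/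

noncomputable section

namespace CompositeSim

/-! ### Scalar estimates for `exp (I x)` -/

/-- The second order Taylor bound for `exp (I x)` on the real line. -/
theorem norm_exp_I_mul_sub_one_sub_le (x : ℝ) :
    ‖Complex.exp (Complex.I * x) - 1 - Complex.I * x‖ ≤ x ^ 2 / 2 := by
  -- Allowing both `c = I` and `c = -I` reduces negative `x` to `-x ≥ 0`. The derivative `c (e^{cu}
  -- - 1)` has norm at most `u`, which integrates to `y²/2`.
  have key : ∀ c : ℂ, (‖c‖ = 1) → c.re = 0 → ∀ y : ℝ, 0 ≤ y →
      ‖Complex.exp (c * y) - 1 - c * y‖ ≤ y ^ 2 / 2 := by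
    intro c hc hre y hy
    have hd : ∀ u : ℝ, HasDerivAt (fun u : ℝ => Complex.exp (c * u) - 1 - c * u)
        (c * (Complex.exp (c * u) - 1)) u := by
      intro u
      have h1 : HasDerivAt (fun u : ℝ => c * (u : ℂ)) c u := by
        simpa using (Complex.ofRealCLM.hasDerivAt (x := u)).const_mul c
      exact ((h1.cexp.sub_const 1).sub h1).congr_deriv (by ring)
    refine image_norm_le_of_norm_deriv_right_le_deriv_boundary (a := 0) (b := y)
      (f := fun u : ℝ => Complex.exp (c * u) - 1 - c * u)
      (f' := fun u : ℝ => c * (Complex.exp (c * u) - 1))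
      (B := fun u => u ^ 2 / 2) (B' := fun u => u)
      (fun u _ => (hd u).continuousAt.continuousWithinAt)
      (fun u _ => (hd u).hasDerivWithinAt) (by simp) (fun u => ?_) (fun u hu => ?_) ⟨hy, le_rfl⟩
    · exact ((hasDerivAt_pow 2 u).div_const 2).congr_deriv (by ring)
    · have hcI : c * u = Complex.I * ((c.im * u : ℝ) : ℂ) := by
        apply Complex.ext <;> simp [hre]
      have him : |c.im| = 1 := by
        rw [← hc, Complex.abs_im_eq_norm.2 hre]
      rw [norm_mul, hc, one_mul, hcI]
      refine Real.norm_exp_I_mul_ofReal_sub_one_le.trans ?_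
      rw [Real.norm_eq_abs, abs_mul, him, one_mul, abs_of_nonneg hu.1]
  rcases le_total 0 x with h | h
  · exact key Complex.I (by simp) (by simp) x h
  · have := key (-Complex.I) (by simp) (by simp) (-x) (by linarith)
    simpa using this

/-- Comes from `|sin y| < |y|`. For `t ≠ 0` this is the source of the strict inequality in the main
theorem. -/
theorem norm_exp_I_mul_sub_one_lt {x : ℝ} (hx : x ≠ 0) :
    ‖Complex.exp (Complex.I * x) - 1‖ < |x| := by
  rw [Complex.norm_exp_I_mul_ofReal_sub_one, norm_mul, Real.norm_eq_abs, Real.norm_eq_abs,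
    abs_two]
  have h := Real.abs_sin_lt_abs (x := x / 2) (div_ne_zero hx two_ne_zero)
  have : |x / 2| = |x| / 2 := by rw [abs_div, abs_two]
  linarith

/-! ### Exponentials of self-adjoint elements in a C⋆-algebra -/

section CStar

variable {𝔸 : Type*} [CStarAlgebra 𝔸]

theorem exp_I_smul_eq_cfc {G : 𝔸} (hG : IsSelfAdjoint G) :
    NormedSpace.exp (Complex.I • G) = cfc (fun z : ℂ => Complex.exp (Complex.I * z)) G := by
  have hn : IsStarNormal G := hG.isStarNormal
  rw [← CFC.complex_exp_eq_normedSpace_exp (a := Complex.I • G),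
    ← cfc_comp_smul Complex.I Complex.exp G]
  rfl

/-- The spectrum of `G` is real and bounded by `‖G‖`, so the scalar bound transfers through the
functional calculus. The separate `τ > 0` keeps the bound strict at the spectral value `0`. -/
theorem norm_exp_I_smul_sub_one_lt {G : 𝔸} (hG : IsSelfAdjoint G) {τ : ℝ} (hτ : 0 < τ)
    (h : ‖G‖ ≤ τ) : ‖NormedSpace.exp (Complex.I • G) - 1‖ < τ := by
  have hn : IsStarNormal G := hG.isStarNormal
  rw [exp_I_smul_eq_cfc hG, ← cfc_one ℂ G, ← cfc_sub _ _ G]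
  refine norm_cfc_lt hτ fun z hz => ?_
  have hz1 : ‖z‖ ≤ ‖G‖ := by
    have : Nontrivial 𝔸 := by
      by_contra hsub
      rw [not_nontrivial_iff_subsingleton] at hsub
      simp at hz
    exact spectrum.norm_le_norm_of_mem hz
  have hz2 : z = (z.re : ℂ) := hG.mem_spectrum_eq_re hz
  rw [hz2] at hz1 ⊢
  rw [Complex.norm_real, Real.norm_eq_abs] at hz1
  by_cases h0 : z.re = 0
  · simpa [h0] using hτ
  · exact (norm_exp_I_mul_sub_one_lt h0).trans_le (hz1.trans h)

theorem norm_exp_I_smul_sub_one_le {G : 𝔸} (hG : IsSelfAdjoint G) :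
    ‖NormedSpace.exp (Complex.I • G) - 1‖ ≤ ‖G‖ := by
  rcases eq_or_ne G 0 with rfl | h
  · simp
  · exact (norm_exp_I_smul_sub_one_lt hG (norm_pos_iff.2 h) le_rfl).le

theorem norm_exp_I_smul_sub_one_sub_le {G : 𝔸} (hG : IsSelfAdjoint G) :
    ‖NormedSpace.exp (Complex.I • G) - 1 - Complex.I • G‖ ≤ ‖G‖ ^ 2 / 2 := by
  have hn : IsStarNormal G := hG.isStarNormal
  have h2 : Complex.I • G = cfc (fun z : ℂ => Complex.I * z) G := by
    rw [cfc_const_mul_id Complex.I G]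
  rw [exp_I_smul_eq_cfc hG, h2, ← cfc_one ℂ G, ← cfc_sub _ _ G, ← cfc_sub _ _ G]
  refine norm_cfc_le (by positivity) fun z hz => ?_
  have hz1 : ‖z‖ ≤ ‖G‖ := by
    have : Nontrivial 𝔸 := by
      by_contra hsub
      rw [not_nontrivial_iff_subsingleton] at hsub
      simp at hz
    exact spectrum.norm_le_norm_of_mem hz
  have hz2 : z = (z.re : ℂ) := hG.mem_spectrum_eq_re hz
  rw [hz2] at hz1 ⊢
  rw [Complex.norm_real, Real.norm_eq_abs] at hz1
  refine (norm_exp_I_mul_sub_one_sub_le z.re).trans ?_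
  rw [← sq_abs]
  gcongr

theorem exp_I_smul_mem_unitary {G : 𝔸} (hG : IsSelfAdjoint G) :
    NormedSpace.exp (Complex.I • G) ∈ unitary 𝔸 :=
  (selfAdjoint.expUnitary ⟨G, hG⟩).2

theorem norm_le_one_of_mem_unitary {U : 𝔸} (hU : U ∈ unitary 𝔸) : ‖U‖ ≤ 1 := by
  nontriviality 𝔸
  exact (CStarRing.norm_of_mem_unitary hU).le

theorem hasDerivAt_exp_smul_real (x : 𝔸) (u : ℝ) :
    HasDerivAt (fun u : ℝ => NormedSpace.exp (u • x)) (NormedSpace.exp (u • x) * x) u :=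
  hasDerivAt_exp_smul_const x u

theorem hasDerivAt_exp_smul_real' (x : 𝔸) (u : ℝ) :
    HasDerivAt (fun u : ℝ => NormedSpace.exp (u • x)) (x * NormedSpace.exp (u • x)) u :=
  hasDerivAt_exp_smul_const' x u

theorem exp_smul_I_smul_mem_unitary {G : 𝔸} (hG : IsSelfAdjoint G) (u : ℝ) :
    NormedSpace.exp (u • (Complex.I • G)) ∈ unitary 𝔸 := by
  rw [smul_comm]
  exact exp_I_smul_mem_unitary (IsSelfAdjoint.smul (.all u) hG)

theorem exp_smul_mul_exp_neg_smul (x : 𝔸) (u : ℝ) :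
    NormedSpace.exp (u • x) * NormedSpace.exp ((-u) • x) = 1 := by
  let _ : NormedAlgebra ℚ 𝔸 := NormedAlgebra.restrictScalars ℚ ℝ 𝔸
  rw [← NormedSpace.exp_add_of_commute (((Commute.refl x).smul_right _).smul_left _), ← add_smul,
    add_neg_cancel, zero_smul, NormedSpace.exp_zero]

theorem hasDerivAt_exp_neg_smul (x : 𝔸) (u : ℝ) :
    HasDerivAt (fun u : ℝ => NormedSpace.exp ((-u) • x)) (-(NormedSpace.exp ((-u) • x) * x)) u := by
  have := (hasDerivAt_exp_smul_real x (-u)).scomp u (hasDerivAt_neg u)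
  rw [neg_one_smul] at this
  exact this

/-- The derivative of `e^{iuB} A e^{-iuB}` is a unitary conjugate of `i[B, A]`, so its norm does not
depend on `u`. -/
theorem norm_exp_smul_mul_sub_le {B : 𝔸} (hB : IsSelfAdjoint B) (A : 𝔸) {u : ℝ} (hu : 0 ≤ u) :
    ‖NormedSpace.exp (u • (Complex.I • B)) * A - A * NormedSpace.exp (u • (Complex.I • B))‖
      ≤ u * ‖A * B - B * A‖ := by
  set K : 𝔸 := Complex.I • B with hK
  set E : ℝ → 𝔸 := fun u => NormedSpace.exp (u • K) with hE
  have hEu : ∀ u, E u ∈ unitary 𝔸 := exp_smul_I_smul_mem_unitary hB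
  have hd : ∀ u, HasDerivAt E (E u * K) u := hasDerivAt_exp_smul_real K
  have hd' : ∀ u, HasDerivAt E (K * E u) u := hasDerivAt_exp_smul_real' K
  have hEn : ∀ u, E u * E (-u) = 1 :=
     exp_smul_mul_exp_neg_smul K
  have hEn' : ∀ u, E (-u) * E u = 1 := by
    intro u; simpa using hEn (-u)
  have hdn : ∀ u, HasDerivAt (fun u => E (-u)) (-(E (-u) * K)) u := hasDerivAt_exp_neg_smul K
  have hcn : ∀ u, E (-u) * K = K * E (-u) := fun u => (hd (-u)).unique (hd' (-u))
  have hg : ∀ u, HasDerivAt (fun u => E u * A * E (-u) - A)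
      (E u * (K * A - A * K) * E (-u)) u := by
    intro u
    refine ((((hd' u).mul_const A).mul (hdn u)).sub_const A).congr_deriv ?_
    have hc : K * E u = E u * K := (hd' u).unique (hd u)
    rw [hc, hcn]
    noncomm_ring
  have hb := norm_image_sub_le_of_norm_deriv_right_le_segment (a := 0) (b := u)
    (f := fun u => E u * A * E (-u) - A) (C := ‖A * B - B * A‖)
    (f' := fun u => E u * (K * A - A * K) * E (-u))
    (fun v _ => (hg v).continuousAt.continuousWithinAt)
    (fun v _ => (hg v).hasDerivWithinAt) (fun v _ => ?_) u ⟨hu, le_rfl⟩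
  · have h0 : E 0 = 1 := by simp [hE]
    simp only [neg_zero, h0, one_mul, mul_one, sub_self, sub_zero] at hb
    have : E u * A - A * E u = (E u * A * E (-u) - A) * E u := by
      rw [sub_mul, mul_assoc _ (E (-u)), hEn', mul_one]
    rw [this, CStarRing.norm_mul_mem_unitary _ (hEu u), mul_comm]
    exact hb
  · rw [CStarRing.norm_mul_mem_unitary _ (hEu _), CStarRing.norm_mem_unitary_mul _ (hEu _), hK,
      smul_mul_assoc, mul_smul_comm, ← smul_sub, norm_smul, Complex.norm_I, one_mul, norm_sub_rev]

/-- The first-order Trotter error of two self-adjoint elements. -/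
theorem norm_exp_add_sub_exp_mul_exp_le {A B : 𝔸} (hA : IsSelfAdjoint A) (hB : IsSelfAdjoint B) :
    ‖NormedSpace.exp (Complex.I • (A + B))
        - NormedSpace.exp (Complex.I • B) * NormedSpace.exp (Complex.I • A)‖
      ≤ ‖A * B - B * A‖ / 2 := by
  have hH : IsSelfAdjoint (A + B) := hA.add hB
  set a : 𝔸 := Complex.I • A with ha
  set b : 𝔸 := Complex.I • B with hb
  have hab : Complex.I • (A + B) = a + b := smul_add _ _ _
  set EA : ℝ → 𝔸 := fun u => NormedSpace.exp (u • a) with hEA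
  set EB : ℝ → 𝔸 := fun u => NormedSpace.exp (u • b) with hEB
  set EH : ℝ → 𝔸 := fun u => NormedSpace.exp (u • (a + b)) with hEH
  have hEAu : ∀ u, EA u ∈ unitary 𝔸 := exp_smul_I_smul_mem_unitary hA
  have hEHu : ∀ u, EH u ∈ unitary 𝔸 := by
    intro u
    rw [hEH, ← hab]
    exact exp_smul_I_smul_mem_unitary hH u
  have hdA : ∀ u, HasDerivAt EA (a * EA u) u := hasDerivAt_exp_smul_real' a
  have hdB : ∀ u, HasDerivAt EB (b * EB u) u := hasDerivAt_exp_smul_real' b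
  have hdH : ∀ u, HasDerivAt (fun u => EH (-u)) (-(EH (-u) * (a + b))) u :=
    hasDerivAt_exp_neg_smul (a + b)
  -- Interaction picture: undoing the exact evolution leaves only `[EB u, a]` in the derivative. Its
  -- norm is at most `u ‖[A, B]‖`, and integrating over `[0, 1]` yields the factor `1/2`.
  have hg : ∀ u, HasDerivAt (fun u => EH (-u) * (EB u * EA u) - 1)
      (EH (-u) * ((EB u * a - a * EB u) * EA u)) u := by
    intro u
    refine (((hdH u).mul ((hdB u).mul (hdA u))).sub_const 1).congr_deriv ?_
    simp only [Pi.mul_apply]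
    noncomm_ring
  have h1 := image_norm_le_of_norm_deriv_right_le_deriv_boundary (a := 0) (b := 1)
    (f := fun u => EH (-u) * (EB u * EA u) - 1)
    (f' := fun u => EH (-u) * ((EB u * a - a * EB u) * EA u))
    (B := fun u => u ^ 2 * (‖A * B - B * A‖ / 2)) (B' := fun u => u * ‖A * B - B * A‖)
    (fun v _ => (hg v).continuousAt.continuousWithinAt)
    (fun v _ => (hg v).hasDerivWithinAt) (by simp [hEH, hEA, hEB]) (fun u => ?_)
    (fun u hu => ?_) (x := 1) ⟨zero_le_one, le_rfl⟩
  · have hEn : EH 1 * EH (-1) = 1 := exp_smul_mul_exp_neg_smul (a + b) 1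
    have e : NormedSpace.exp (Complex.I • (A + B)) - NormedSpace.exp b * NormedSpace.exp a
        = -(EH 1 * (EH (-1) * (EB 1 * EA 1) - 1)) := by
      rw [mul_sub, ← mul_assoc, hEn, one_mul, mul_one, hab]
      simp [hEH, hEB, hEA]
    rw [e, norm_neg, CStarRing.norm_mem_unitary_mul _ (hEHu 1)]
    simpa using h1
  · exact ((hasDerivAt_pow 2 u).mul_const (‖A * B - B * A‖ / 2)).congr_deriv (by ring)
  · rw [CStarRing.norm_mem_unitary_mul _ (hEHu _), CStarRing.norm_mul_mem_unitary _ (hEAu _)]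
    refine le_trans (le_of_eq ?_) (norm_exp_smul_mul_sub_le hB A hu.1)
    rw [ha, mul_smul_comm, smul_mul_assoc, ← smul_sub, norm_smul, Complex.norm_I, one_mul]

end CStar

/-! ### Duality of the trace norm and the spectral norm -/

section TraceNorm

variable {n : Type*} [Fintype n] [DecidableEq n]

theorem norm_col_le_l2_opNorm (M : Matrix n n ℂ) (i : n) :
    ‖WithLp.toLp 2 (fun k => M k i)‖ ≤ ‖M‖ := by
  have h := M.l2_opNorm_mulVec (EuclideanSpace.single i 1)
  rw [PiLp.norm_single, norm_one, mul_one] at h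
  rwa [show (EuclideanSpace.single i (1 : ℂ) : EuclideanSpace ℂ n).ofLp = Pi.single i 1 from
    PiLp.ofLp_single 2 i 1, Matrix.mulVec_single_one] at h

theorem norm_col_eq_sqrt {Y : Matrix n n ℂ} {l : n → ℝ}
    (h : Yᴴ * Y = Matrix.diagonal fun i => (l i : ℂ)) (i : n) :
    ‖WithLp.toLp 2 (fun k => Y k i)‖ = √(l i) := by
  rw [EuclideanSpace.norm_eq]
  congr 1
  have h1 := congrFun (congrFun h i) i
  rw [Matrix.mul_apply, Matrix.diagonal_apply_eq] at h1
  apply Complex.ofReal_injective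
  rw [← h1]
  push_cast
  refine Finset.sum_congr rfl fun k _ => ?_
  rw [Matrix.conjTranspose_apply, RCLike.star_def, Complex.conj_mul']

/-- Stands in for a singular value decomposition: the columns of `X * V` are orthogonal, and their
lengths are the singular values of `X`. -/
theorem eigenvectorUnitary_conjTranspose_mul_self (X : Matrix n n ℂ) :
    let V : Matrix n n ℂ := (Matrix.isHermitian_conjTranspose_mul_self X).eigenvectorUnitary
    (X * V)ᴴ * (X * V) = Matrix.diagonal
      fun i => ((Matrix.isHermitian_conjTranspose_mul_self X).eigenvalues i : ℂ) := by
  intro V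
  have h := (Matrix.isHermitian_conjTranspose_mul_self X).conjStarAlgAut_star_eigenvectorUnitary
  rw [Unitary.conjStarAlgAut_star_apply] at h
  rw [Matrix.conjTranspose_mul, ← Matrix.mul_assoc, Matrix.mul_assoc _ Xᴴ X]
  exact h

theorem traceNorm_nonneg (X : Matrix n n ℂ) : 0 ≤ traceNorm X :=
  Finset.sum_nonneg fun _ _ => Real.sqrt_nonneg _

/-- The trace is a sum of inner products of the columns of `W†V` and `XV`. Cauchy–Schwarz bounds
each by `‖W‖` times a singular value. -/
theorem norm_trace_mul_le (W X : Matrix n n ℂ) : ‖(W * X).trace‖ ≤ ‖W‖ * traceNorm X := by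
  set V := (Matrix.isHermitian_conjTranspose_mul_self X).eigenvectorUnitary with hV
  have hY := eigenvectorUnitary_conjTranspose_mul_self X
  set Y : Matrix n n ℂ := X * (V : Matrix n n ℂ) with hYdef
  set M : Matrix n n ℂ := Wᴴ * (V : Matrix n n ℂ) with hM
  have hVV : (V : Matrix n n ℂ) * (V : Matrix n n ℂ)ᴴ = 1 := Unitary.mul_star_self_of_mem V.2
  have h1 : (W * X).trace = (Mᴴ * Y).trace := by
    rw [hM, Matrix.conjTranspose_mul, Matrix.conjTranspose_conjTranspose,
      Matrix.trace_mul_comm _ Y, hYdef, Matrix.mul_assoc, ← Matrix.mul_assoc (V : Matrix n n ℂ),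
      hVV, Matrix.one_mul, Matrix.trace_mul_comm]
  have hMW : ‖M‖ ≤ ‖W‖ := by
    rw [hM, CStarRing.norm_mul_mem_unitary _ V.2, Matrix.l2_opNorm_conjTranspose]
  rw [h1, Matrix.trace, traceNorm, Finset.mul_sum]
  refine (norm_sum_le _ _).trans (Finset.sum_le_sum fun i _ => ?_)
  have h2 : (Mᴴ * Y).diag i
      = inner ℂ (WithLp.toLp 2 (fun k => M k i)) (WithLp.toLp 2 (fun k => Y k i)) := by
    rw [Matrix.diag_apply, Matrix.mul_apply, PiLp.inner_apply]
    refine Finset.sum_congr rfl fun k _ => ?_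
    simp [mul_comm]
  rw [h2]
  refine (norm_inner_le_norm _ _).trans ?_
  rw [norm_col_eq_sqrt hY]
  gcongr
  exact (norm_col_le_l2_opNorm M i).trans hMW

theorem exists_trace_mul_eq_traceNorm (X : Matrix n n ℂ) :
    ∃ W : Matrix n n ℂ, ‖W‖ ≤ 1 ∧ (W * X).trace = traceNorm X := by
  set V := (Matrix.isHermitian_conjTranspose_mul_self X).eigenvectorUnitary with hV
  have hY := eigenvectorUnitary_conjTranspose_mul_self X
  set l := (Matrix.isHermitian_conjTranspose_mul_self X).eigenvalues with hl
  have hl0 : ∀ i, 0 ≤ l i := Matrix.eigenvalues_conjTranspose_mul_self_nonneg X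
  set Y : Matrix n n ℂ := X * (V : Matrix n n ℂ) with hYdef
  -- The witness is the adjoint of the polar part of `X`. The convention `0⁻¹ = 0` kills the kernel
  -- of `X`, so no invertibility is needed.
  set D : Matrix n n ℂ := Matrix.diagonal fun i => (((√(l i))⁻¹ : ℝ) : ℂ) with hD
  have hDD : Dᴴ = D := by
    rw [hD, Matrix.diagonal_conjTranspose]
    congr 1; ext i; simp
  refine ⟨V * (D * Yᴴ), ?_, ?_⟩
  · rw [CStarRing.norm_mem_unitary_mul _ V.2]
    have h1 : ‖(D * Yᴴ)ᴴ‖ * ‖(D * Yᴴ)ᴴ‖ ≤ 1 := by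
      rw [← Matrix.l2_opNorm_conjTranspose_mul_self, Matrix.conjTranspose_conjTranspose,
        Matrix.conjTranspose_mul D, Matrix.conjTranspose_conjTranspose, hDD, Matrix.mul_assoc,
        ← Matrix.mul_assoc Yᴴ, hY, hD, Matrix.diagonal_mul_diagonal, Matrix.diagonal_mul_diagonal,
        Matrix.l2_opNorm_diagonal, pi_norm_le_iff_of_nonneg zero_le_one]
      intro i
      rcases (hl0 i).eq_or_lt with h | h
      · simp [← h]
      · have hs : (√(l i))⁻¹ * (l i * (√(l i))⁻¹) = 1 := by
          have := Real.mul_self_sqrt h.le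
          have hp := Real.sqrt_pos.2 h
          field_simp
          rw [sq, this]
        rw [← Complex.ofReal_mul, ← Complex.ofReal_mul, hs]; simp
    rw [Matrix.l2_opNorm_conjTranspose] at h1
    nlinarith [norm_nonneg (D * Yᴴ)]
  · rw [Matrix.mul_assoc, Matrix.trace_mul_comm, Matrix.mul_assoc, ← hYdef, Matrix.mul_assoc, hY,
      hD, Matrix.diagonal_mul_diagonal, Matrix.trace_diagonal, traceNorm]
    push_cast
    refine Finset.sum_congr rfl fun i _ => ?_
    rw [← Complex.ofReal_inv, ← Complex.ofReal_mul, ← hl]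
    congr 1
    rw [inv_mul_eq_div, Real.div_sqrt]

theorem traceNorm_le_of_forall {X : Matrix n n ℂ} {c : ℝ}
    (h : ∀ W : Matrix n n ℂ, ‖W‖ ≤ 1 → ‖(W * X).trace‖ ≤ c) : traceNorm X ≤ c := by
  obtain ⟨W, hW, hX⟩ := exists_trace_mul_eq_traceNorm X
  have := h W hW
  rw [hX, Complex.norm_real, Real.norm_of_nonneg (traceNorm_nonneg X)] at this
  exact this

theorem traceNorm_add_le (X Y : Matrix n n ℂ) :
    traceNorm (X + Y) ≤ traceNorm X + traceNorm Y := by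
  refine traceNorm_le_of_forall fun W hW => ?_
  rw [Matrix.mul_add, Matrix.trace_add]
  refine (norm_add_le _ _).trans (add_le_add ?_ ?_)
  · exact (norm_trace_mul_le W X).trans (mul_le_of_le_one_left (traceNorm_nonneg X) hW)
  · exact (norm_trace_mul_le W Y).trans (mul_le_of_le_one_left (traceNorm_nonneg Y) hW)

theorem traceNorm_smul_le (c : ℂ) (X : Matrix n n ℂ) :
    traceNorm (c • X) ≤ ‖c‖ * traceNorm X := by
  refine traceNorm_le_of_forall fun W hW => ?_
  rw [Matrix.mul_smul, Matrix.trace_smul, norm_smul]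
  gcongr
  exact (norm_trace_mul_le W X).trans (mul_le_of_le_one_left (traceNorm_nonneg X) hW)

theorem traceNorm_mul_mul_le (P X Q : Matrix n n ℂ) :
    traceNorm (P * X * Q) ≤ ‖P‖ * ‖Q‖ * traceNorm X := by
  refine traceNorm_le_of_forall fun W hW => ?_
  have : (W * (P * X * Q)).trace = (Q * W * P * X).trace := by
    rw [← Matrix.mul_assoc, Matrix.trace_mul_comm]
    simp only [Matrix.mul_assoc]
  rw [this]
  refine (norm_trace_mul_le _ X).trans (mul_le_mul_of_nonneg_right ?_ (traceNorm_nonneg X))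
  calc ‖Q * W * P‖ ≤ ‖Q‖ * ‖W‖ * ‖P‖ := (norm_mul_le _ _).trans (by gcongr; exact norm_mul_le _ _)
    _ ≤ ‖Q‖ * 1 * ‖P‖ := by gcongr
    _ = ‖P‖ * ‖Q‖ := by ring

theorem traceNorm_zero : traceNorm (0 : Matrix n n ℂ) = 0 := by
  refine le_antisymm ?_ (traceNorm_nonneg _)
  simpa using traceNorm_smul_le (0 : ℂ) (0 : Matrix n n ℂ)

end TraceNorm

/-! ### Calculus of diamond-norm bounds -/

section Diamond

variable {d : Type*} [Fintype d] [DecidableEq d]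

/-- The map `ρ ↦ P ρ Q†`. -/
def sandwich (P Q : Matrix d d ℂ) : SuperOp d where
  toFun ρ := P * ρ * Qᴴ
  map_add' ρ σ := by rw [Matrix.mul_add, Matrix.add_mul]
  map_smul' c ρ := by simp

theorem sandwich_apply (P Q ρ : Matrix d d ℂ) : sandwich P Q ρ = P * ρ * Qᴴ := rfl

theorem conjBy_apply (U ρ : Matrix d d ℂ) : conjBy U ρ = U * ρ * Uᴴ := rfl

theorem conjBy_one : conjBy (1 : Matrix d d ℂ) = 1 := by
  ext1 ρ
  simp [conjBy_apply]

theorem conjBy_mul (U V : Matrix d d ℂ) : conjBy (U * V) = conjBy U * conjBy V := by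
  ext1 ρ
  simp [conjBy_apply, Module.End.mul_apply, Matrix.mul_assoc]

theorem conjBy_pow (U : Matrix d d ℂ) (m : ℕ) : conjBy (U ^ m) = conjBy U ^ m := by
  induction m with
  | zero => simp [conjBy_one]
  | succ m ih => rw [pow_succ, pow_succ, conjBy_mul, ih]

/-- The star algebra homomorphism `P ↦ P ⊗ 1`. -/
def kroneckerOneHom (d : Type*) [Fintype d] [DecidableEq d] (k : ℕ) :
    Matrix d d ℂ →⋆ₙₐ[ℂ] Matrix (d × Fin k) (d × Fin k) ℂ where
  toFun P := Matrix.kroneckerMap (· * ·) P 1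
  map_smul' c P := Matrix.smul_kronecker c P 1
  map_zero' := Matrix.zero_kronecker 1
  map_add' P Q := Matrix.add_kronecker P Q 1
  map_mul' P Q := by
    rw [← Matrix.mul_kronecker_mul, one_mul]
  map_star' P := by
    rw [Matrix.star_eq_conjTranspose, Matrix.star_eq_conjTranspose, Matrix.conjTranspose_kronecker,
      Matrix.conjTranspose_one]

theorem ampliate_sandwich (k : ℕ) (P Q : Matrix d d ℂ) (X : Matrix (d × Fin k) (d × Fin k) ℂ) :
    ampliate k (sandwich P Q) X = kroneckerOneHom d k P * X * (kroneckerOneHom d k Q)ᴴ := by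
  ext ⟨i, a⟩ ⟨j, b⟩
  simp only [ampliate, sandwich_apply, Matrix.of_apply, Matrix.mul_apply, kroneckerOneHom,
    NonUnitalStarAlgHom.coe_mk', NonUnitalAlgHom.coe_mk, Matrix.conjTranspose_apply,
    Matrix.kroneckerMap_apply, Fintype.sum_prod_type, Matrix.one_apply]
  simp [apply_ite]

/-- `Φ` has diamond norm at most `c`. -/
def DiamondLE (Φ : SuperOp d) (c : ℝ) : Prop :=
  ∀ (k : ℕ) (X : Matrix (d × Fin k) (d × Fin k) ℂ), traceNorm (ampliate k Φ X) ≤ c * traceNorm X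

theorem DiamondLE.mono {Φ : SuperOp d} {c c' : ℝ} (h : DiamondLE Φ c) (hc : c ≤ c') :
    DiamondLE Φ c' := fun k X =>
  (h k X).trans (mul_le_mul_of_nonneg_right hc (traceNorm_nonneg X))

theorem DiamondLE.zero : DiamondLE (0 : SuperOp d) 0 := fun k X => by
  have : ampliate k (0 : SuperOp d) X = 0 := by ext; simp [ampliate]
  rw [this, traceNorm_zero, zero_mul]

theorem DiamondLE.add {Φ Ψ : SuperOp d} {a b : ℝ} (h : DiamondLE Φ a) (h' : DiamondLE Ψ b) :
    DiamondLE (Φ + Ψ) (a + b) := fun k X => by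
  have : ampliate k (Φ + Ψ) X = ampliate k Φ X + ampliate k Ψ X := by ext; simp [ampliate]
  rw [this, add_mul]
  exact (traceNorm_add_le _ _).trans (add_le_add (h k X) (h' k X))

theorem DiamondLE.smul {Φ : SuperOp d} {a : ℝ} (c : ℂ) (h : DiamondLE Φ a) :
    DiamondLE (c • Φ) (‖c‖ * a) := fun k X => by
  have : ampliate k (c • Φ) X = c • ampliate k Φ X := by ext; simp [ampliate]
  rw [this, mul_assoc]
  exact (traceNorm_smul_le _ _).trans (mul_le_mul_of_nonneg_left (h k X) (norm_nonneg c))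

theorem DiamondLE.sub {Φ Ψ : SuperOp d} {a b : ℝ} (h : DiamondLE Φ a) (h' : DiamondLE Ψ b) :
    DiamondLE (Φ - Ψ) (a + b) := by
  have h2 := h'.smul (-1)
  have e : Φ - Ψ = Φ + (-1 : ℂ) • Ψ := by
    ext1 ρ
    rw [LinearMap.sub_apply, LinearMap.add_apply, LinearMap.smul_apply, neg_smul, one_smul,
      sub_eq_add_neg]
  rw [norm_neg, norm_one, one_mul] at h2
  rw [e]
  exact h.add h2

theorem DiamondLE.sum {ι : Type*} (s : Finset ι) {Φ : ι → SuperOp d} {a : ι → ℝ}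
    (h : ∀ i ∈ s, DiamondLE (Φ i) (a i)) : DiamondLE (∑ i ∈ s, Φ i) (∑ i ∈ s, a i) := by
  classical
  induction s using Finset.induction_on with
  | empty => simpa using DiamondLE.zero
  | insert i s hi ih =>
    rw [Finset.sum_insert hi, Finset.sum_insert hi]
    exact (h i (Finset.mem_insert_self i s)).add
      (ih fun j hj => h j (Finset.mem_insert_of_mem hj))

theorem DiamondLE.mul {Φ Ψ : SuperOp d} {a b : ℝ} (ha : 0 ≤ a) (h : DiamondLE Φ a)
    (h' : DiamondLE Ψ b) : DiamondLE (Φ * Ψ) (a * b) := fun k X => by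
  have : ampliate k (Φ * Ψ) X = ampliate k Φ (ampliate k Ψ X) := rfl
  rw [this, mul_assoc]
  exact (h k _).trans (mul_le_mul_of_nonneg_left (h' k X) ha)

theorem DiamondLE.one : DiamondLE (1 : SuperOp d) 1 := fun k X => by
  rw [one_mul]; exact le_rfl

/-- Ampliation replaces `P` by `P ⊗ 1`; star homomorphisms are contractive, so the bound is uniform
in `k`. -/
theorem DiamondLE.sandwich (P Q : Matrix d d ℂ) :
    DiamondLE (CompositeSim.sandwich P Q) (‖P‖ * ‖Q‖) := fun k X => by
  rw [ampliate_sandwich]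
  refine (traceNorm_mul_mul_le _ _ _).trans
    (mul_le_mul_of_nonneg_right ?_ (traceNorm_nonneg X))
  rw [Matrix.l2_opNorm_conjTranspose]
  gcongr
  · exact NonUnitalStarAlgHom.norm_apply_le (kroneckerOneHom d k) P
  · exact NonUnitalStarAlgHom.norm_apply_le (kroneckerOneHom d k) Q

theorem DiamondLE.conjBy {U : Matrix d d ℂ} (hU : ‖U‖ ≤ 1) :
    DiamondLE (CompositeSim.conjBy U) 1 :=
  (DiamondLE.sandwich U U).mono (mul_le_one₀ hU (norm_nonneg U) hU)

theorem DiamondLE.conjBy_sub_conjBy {U V : Matrix d d ℂ} (hU : ‖U‖ ≤ 1) (hV : ‖V‖ ≤ 1) :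
    DiamondLE (CompositeSim.conjBy U - CompositeSim.conjBy V) (2 * ‖U - V‖) := by
  have : CompositeSim.conjBy U - CompositeSim.conjBy V
      = CompositeSim.sandwich (U - V) U + CompositeSim.sandwich V (U - V) := by
    ext1 ρ
    simp only [LinearMap.sub_apply, LinearMap.add_apply, conjBy_apply, sandwich_apply,
      Matrix.conjTranspose_sub, Matrix.sub_mul, Matrix.mul_sub]
    abel
  rw [this]
  refine ((DiamondLE.sandwich _ _).add (DiamondLE.sandwich _ _)).mono ?_
  nlinarith [norm_nonneg (U - V)]

theorem DiamondLE.pow {Φ : SuperOp d} (h : DiamondLE Φ 1) (m : ℕ) : DiamondLE (Φ ^ m) 1 := by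
  induction m with
  | zero => exact DiamondLE.one
  | succ m ih =>
    rw [pow_succ]
    simpa using ih.mul zero_le_one h

/-- Telescoping: errors add up because the remaining factors are contractions. -/
theorem DiamondLE.pow_sub_pow {Φ Ψ : SuperOp d} {c : ℝ} (hΦ : DiamondLE Φ 1) (hΨ : DiamondLE Ψ 1)
    (hc : 0 ≤ c) (h : DiamondLE (Φ - Ψ) c) (m : ℕ) : DiamondLE (Φ ^ m - Ψ ^ m) (m * c) := by
  induction m with
  | zero => simpa using DiamondLE.zero
  | succ m ih =>
    have e : Φ ^ (m + 1) - Ψ ^ (m + 1) = (Φ ^ m - Ψ ^ m) * Φ + Ψ ^ m * (Φ - Ψ) := by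
      rw [pow_succ, pow_succ, sub_mul, mul_sub]; abel
    rw [e]
    refine ((ih.mul (by positivity) hΦ).add ((hΨ.pow m).mul zero_le_one h)).mono ?_
    push_cast
    linarith

theorem DiamondLE.diamondNorm_le {Φ : SuperOp d} {c : ℝ} (hc : 0 ≤ c) (h : DiamondLE Φ c) :
    diamondNorm Φ ≤ ENNReal.ofReal c :=
  iSup_le fun k => iSup_le fun X => iSup_le fun hX => ENNReal.ofReal_le_ofReal <|
    (h k X).trans (mul_le_of_le_one_right hc hX)

end Diamond

/-! ### One-step errors of Trotter, QDrift and the composite channel -/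

section Bounds

variable {d : Type*} [Fintype d] [DecidableEq d]

theorem expI_eq (M : Matrix d d ℂ) (t : ℝ) :
    expI M t = NormedSpace.exp (Complex.I • ((t : ℂ) • M)) := by
  rw [expI, mul_smul]

theorem isSelfAdjoint_ofReal_smul {M : Matrix d d ℂ} (hM : M.IsHermitian) (t : ℝ) :
    IsSelfAdjoint ((t : ℂ) • M) :=
  IsSelfAdjoint.smul (Complex.conj_ofReal t) hM

theorem norm_expI_le_one {M : Matrix d d ℂ} (hM : M.IsHermitian) (t : ℝ) : ‖expI M t‖ ≤ 1 := by
  rw [expI_eq]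
  exact norm_le_one_of_mem_unitary (exp_I_smul_mem_unitary (isSelfAdjoint_ofReal_smul hM t))

theorem expI_smul (M : Matrix d d ℂ) (a t : ℝ) : expI M (a * t) = expI ((a : ℂ) • M) t := by
  rw [expI, expI, smul_smul]
  push_cast
  congr 2
  ring

theorem expI_nat_mul (M : Matrix d d ℂ) (m : ℕ) (t : ℝ) : expI M (m * t) = expI M t ^ m := by
  rw [expI, expI, ← Matrix.exp_nsmul, ← Nat.cast_smul_eq_nsmul ℂ, smul_smul]
  push_cast
  congr 2
  ring

theorem expI_zero (M : Matrix d d ℂ) : expI M 0 = 1 := by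
  simp [expI]

theorem Hamiltonian.isHermitian_op (A : Hamiltonian d) : A.op.IsHermitian := by
  rw [Hamiltonian.op]
  exact isSelfAdjoint_sum _ fun i _ => isSelfAdjoint_ofReal_smul (A.isHermitian i) (A.h i)

theorem Hamiltonian.norm_op_le (A : Hamiltonian d) : ‖A.op‖ ≤ A.lam := by
  refine (norm_sum_le _ _).trans (Finset.sum_le_sum fun i _ => ?_)
  rw [norm_smul, A.norm_eq_one, mul_one, Complex.norm_real, Real.norm_of_nonneg (A.h_nonneg i)]

/-- The first-order Trotter error of two Hermitian matrices. -/
theorem norm_expI_add_sub_le {M N : Matrix d d ℂ} (hM : M.IsHermitian) (hN : N.IsHermitian)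
    (t : ℝ) :
    ‖expI (M + N) t - expI N t * expI M t‖ ≤ t ^ 2 / 2 * ‖M * N - N * M‖ := by
  have h := norm_exp_add_sub_exp_mul_exp_le (isSelfAdjoint_ofReal_smul hM t)
    (isSelfAdjoint_ofReal_smul hN t)
  rw [← smul_add, ← expI_eq, ← expI_eq, ← expI_eq] at h
  refine h.trans (le_of_eq ?_)
  rw [smul_mul_smul_comm, smul_mul_smul_comm, ← smul_sub, norm_smul, norm_mul, Complex.norm_real,
    ← sq, Real.norm_eq_abs, sq_abs]
  ring

theorem norm_sum_commutator_le {ι : Type*} (s : Finset ι) (a : ι → ℝ) (ha : ∀ i, 0 ≤ a i)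
    (M : ι → Matrix d d ℂ) (b : ℝ) (hb : 0 ≤ b) (N : Matrix d d ℂ) :
    ‖(∑ i ∈ s, (a i : ℂ) • M i) * ((b : ℂ) • N) - ((b : ℂ) • N) * ∑ i ∈ s, (a i : ℂ) • M i‖
      ≤ ∑ i ∈ s, a i * b * ‖M i * N - N * M i‖ := by
  rw [Finset.sum_mul, Finset.mul_sum, ← Finset.sum_sub_distrib]
  refine (norm_sum_le _ _).trans (Finset.sum_le_sum fun i _ => le_of_eq ?_)
  rw [smul_mul_smul_comm, smul_mul_smul_comm, mul_comm (b : ℂ), ← smul_sub, norm_smul, norm_mul,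
    Complex.norm_real, Complex.norm_real, Real.norm_of_nonneg (ha i), Real.norm_of_nonneg hb]

theorem norm_list_prod_le_one (l : List (Matrix d d ℂ)) (h : ∀ M ∈ l, ‖M‖ ≤ 1) :
    ‖l.prod‖ ≤ 1 := by
  induction l with
  | nil =>
    rw [List.prod_nil]
    exact norm_le_one_of_mem_unitary (one_mem _)
  | cons M l ih =>
    rw [List.prod_cons]
    refine (norm_mul_le _ _).trans (mul_le_one₀ (h M (by simp)) (norm_nonneg _) ?_)
    exact ih fun N hN => h N (by simp [hN])

theorem norm_trotter_prod_le_one {m : ℕ} (a : Fin m → ℝ) {M : Fin m → Matrix d d ℂ}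
    (hM : ∀ i, (M i).IsHermitian) (t : ℝ) :
    ‖(List.ofFn fun i => expI (M i) (a i * t)).reverse.prod‖ ≤ 1 := by
  refine norm_list_prod_le_one _ fun N hN => ?_
  rw [List.mem_reverse, List.mem_ofFn] at hN
  obtain ⟨i, rfl⟩ := hN
  exact norm_expI_le_one (hM i) _

theorem norm_expI_sum_sub_trotter_prod_le {m : ℕ} (a : Fin m → ℝ) (ha : ∀ i, 0 ≤ a i)
    (M : Fin m → Matrix d d ℂ) (hM : ∀ i, (M i).IsHermitian) (t : ℝ) :
    ‖expI (∑ i, (a i : ℂ) • M i) t - (List.ofFn fun i => expI (M i) (a i * t)).reverse.prod‖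
      ≤ t ^ 2 / 4 * ∑ i, ∑ j, a i * a j * ‖M i * M j - M j * M i‖ := by
  induction m with
  | zero => simp [expI]
  | succ m ih =>
    have ih' := ih (fun i => a i.castSucc) (fun i => ha _) (fun i => M i.castSucc) fun i => hM _
    set S := ∑ i : Fin m, (a i.castSucc : ℂ) • M i.castSucc with hS
    set P := (List.ofFn fun i : Fin m => expI (M i.castSucc) (a i.castSucc * t)).reverse.prod
    set l := Fin.last m
    have hSh : S.IsHermitian :=
      isSelfAdjoint_sum _ fun i _ => isSelfAdjoint_ofReal_smul (hM _) _
    have hprod : (List.ofFn fun i => expI (M i) (a i * t)).reverse.prod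
        = expI (M l) (a l * t) * P := by
      rw [List.ofFn_succ', List.concat_eq_append, List.reverse_append]
      simp [P, l]
    have h1 := norm_expI_add_sub_le hSh
      (show ((a l : ℂ) • M l).IsHermitian from isSelfAdjoint_ofReal_smul (hM l) (a l)) t
    have h2 := norm_sum_commutator_le Finset.univ (fun i : Fin m => a i.castSucc) (fun i => ha _)
      (fun i => M i.castSucc) (a l) (ha l) (M l)
    -- The double sum counts each unordered pair twice, and the diagonal vanishes. Thus the constant
    -- `t²/4` matches the `t²/2` paid when the last term is split off.
    have hsum : ∑ i, ∑ j, a i * a j * ‖M i * M j - M j * M i‖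
        = (∑ i : Fin m, ∑ j : Fin m, a i.castSucc * a j.castSucc
            * ‖M i.castSucc * M j.castSucc - M j.castSucc * M i.castSucc‖)
          + 2 * ∑ i : Fin m, a i.castSucc * a l
            * ‖M i.castSucc * M l - M l * M i.castSucc‖ := by
      rw [Fin.sum_univ_castSucc]
      simp only [Fin.sum_univ_castSucc (n := m)]
      rw [Finset.sum_add_distrib, sub_self, norm_zero, mul_zero, add_zero, two_mul, add_assoc]
      congr 2
      refine Finset.sum_congr rfl fun i _ => ?_
      rw [norm_sub_rev, mul_comm (a (Fin.last m))]
    rw [Fin.sum_univ_castSucc, hprod, hsum]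
    have e : expI (S + (a l : ℂ) • M l) t - expI (M l) (a l * t) * P
        = (expI (S + (a l : ℂ) • M l) t - expI ((a l : ℂ) • M l) t * expI S t)
          + expI (M l) (a l * t) * (expI S t - P) := by
      rw [← expI_smul, mul_sub]; abel
    rw [e]
    have h3 : ‖expI (M l) (a l * t) * (expI S t - P)‖ ≤ ‖expI S t - P‖ :=
      (norm_mul_le _ _).trans
        (mul_le_of_le_one_left (norm_nonneg _) (norm_expI_le_one (hM l) _))
    have h4 := mul_le_mul_of_nonneg_left h2 (show 0 ≤ t ^ 2 / 2 by positivity)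
    refine (norm_add_le _ _).trans ?_
    linarith

/-- The operator error of one step of the composite formula with an exact evolution under `B`. -/
theorem norm_expI_op_add_sub_trotterUnitary_le (A B : Hamiltonian d) (s : ℝ) :
    ‖expI (A.op + B.op) s - expI B.op s * trotterUnitary A s‖
      ≤ s ^ 2 / 2 * ((∑ i, ∑ j, A.h i * A.h j * ‖A.H i * A.H j - A.H j * A.H i‖)
        + ∑ i, ∑ j, A.h i * B.h j * ‖A.H i * B.H j - B.H j * A.H i‖) := by
  have h1 := norm_expI_add_sub_le A.isHermitian_op B.isHermitian_op s
  have h2 : ‖expI A.op s - trotterUnitary A s‖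
      ≤ s ^ 2 / 4 * ∑ i, ∑ j, A.h i * A.h j * ‖A.H i * A.H j - A.H j * A.H i‖ :=
    norm_expI_sum_sub_trotter_prod_le A.h A.h_nonneg A.H A.isHermitian s
  have h3 : ‖A.op * B.op - B.op * A.op‖
      ≤ ∑ i, ∑ j, A.h i * B.h j * ‖A.H i * B.H j - B.H j * A.H i‖ := by
    have e : A.op * B.op - B.op * A.op
        = ∑ j, (A.op * ((B.h j : ℂ) • B.H j) - ((B.h j : ℂ) • B.H j) * A.op) := by
      rw [Finset.sum_sub_distrib, ← Finset.mul_sum, ← Finset.sum_mul]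
      rfl
    rw [e, Finset.sum_comm]
    exact (norm_sum_le _ _).trans (Finset.sum_le_sum fun j _ =>
      norm_sum_commutator_le _ A.h A.h_nonneg A.H (B.h j) (B.h_nonneg j) (B.H j))
  have h0 : 0 ≤ ∑ i, ∑ j, A.h i * A.h j * ‖A.H i * A.H j - A.H j * A.H i‖ :=
    Finset.sum_nonneg fun i _ => Finset.sum_nonneg fun j _ =>
      mul_nonneg (mul_nonneg (A.h_nonneg i) (A.h_nonneg j)) (norm_nonneg _)
  have e : expI (A.op + B.op) s - expI B.op s * trotterUnitary A s
      = (expI (A.op + B.op) s - expI B.op s * expI A.op s)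
        + expI B.op s * (expI A.op s - trotterUnitary A s) := by
    rw [mul_sub]; abel
  have h4 : ‖expI B.op s * (expI A.op s - trotterUnitary A s)‖
      ≤ ‖expI A.op s - trotterUnitary A s‖ :=
    (norm_mul_le _ _).trans
      (mul_le_of_le_one_left (norm_nonneg _) (norm_expI_le_one B.isHermitian_op _))
  rw [e]
  refine (norm_add_le _ _).trans ?_
  have h5 := mul_le_mul_of_nonneg_left h3 (show 0 ≤ s ^ 2 / 2 by positivity)
  -- Slack: the Trotter part only needs `s²/4`, but `s²/2` is claimed for both sums.
  have h6 := mul_nonneg (show 0 ≤ s ^ 2 / 4 by positivity) h0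
  linarith

/-- Separates the parts linear in `U - 1` or its adjoint, which can be averaged over samples, from
the quadratic part. -/
theorem conjBy_eq_one_add (U : Matrix d d ℂ) :
    conjBy U = 1 + sandwich (U - 1) 1 + sandwich 1 (U - 1) + sandwich (U - 1) (U - 1) := by
  ext1 ρ
  simp only [LinearMap.add_apply, conjBy_apply, sandwich_apply, Module.End.one_apply,
    Matrix.conjTranspose_sub, Matrix.conjTranspose_one, Matrix.sub_mul, Matrix.mul_sub,
    Matrix.one_mul, Matrix.mul_one]
  abel

theorem sum_smul_sandwich_one {ι : Type*} (s : Finset ι) (p : ι → ℝ) (E : ι → Matrix d d ℂ) :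
    ∑ i ∈ s, (p i : ℂ) • sandwich (E i) 1 = sandwich (∑ i ∈ s, (p i : ℂ) • E i) 1 := by
  ext1 ρ
  simp [LinearMap.sum_apply, sandwich_apply, Finset.sum_mul]

theorem sum_smul_sandwich_one_left {ι : Type*} (s : Finset ι) (p : ι → ℝ)
    (E : ι → Matrix d d ℂ) :
    ∑ i ∈ s, (p i : ℂ) • sandwich 1 (E i) = sandwich 1 (∑ i ∈ s, (p i : ℂ) • E i) := by
  ext1 ρ
  simp [LinearMap.sum_apply, sandwich_apply, Finset.mul_sum, Matrix.conjTranspose_sum]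

theorem sum_smul_conjBy {ι : Type*} (s : Finset ι) (p : ι → ℝ) (hp : ∑ i ∈ s, p i = 1)
    (U : ι → Matrix d d ℂ) :
    ∑ i ∈ s, (p i : ℂ) • conjBy (U i)
      = 1 + sandwich (∑ i ∈ s, (p i : ℂ) • (U i - 1)) 1
        + sandwich 1 (∑ i ∈ s, (p i : ℂ) • (U i - 1))
        + ∑ i ∈ s, (p i : ℂ) • sandwich (U i - 1) (U i - 1) := by
  have h1 : (∑ i ∈ s, (p i : ℂ) • (1 : SuperOp d)) = 1 := by
    rw [← Finset.sum_smul, ← Complex.ofReal_sum, hp, Complex.ofReal_one, one_smul]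
  rw [← sum_smul_sandwich_one, ← sum_smul_sandwich_one_left]
  nth_rw 1 [← h1]
  rw [← Finset.sum_add_distrib, ← Finset.sum_add_distrib, ← Finset.sum_add_distrib]
  refine Finset.sum_congr rfl fun i _ => ?_
  rw [← smul_add, ← smul_add, ← smul_add, ← conjBy_eq_one_add]

theorem Hamiltonian.sum_prob (B : Hamiltonian d) (hB : 0 < B.lam) :
    ∑ i, B.h i / B.lam = 1 := by
  rw [← Finset.sum_div]
  exact div_self hB.ne'

theorem DiamondLE.qdriftSample (B : Hamiltonian d) (hB : 0 < B.lam) (s : ℝ) :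
    DiamondLE (CompositeSim.qdriftSample B s) 1 := by
  refine (DiamondLE.sum Finset.univ fun i _ =>
    (DiamondLE.conjBy (norm_expI_le_one (B.isHermitian i) _)).smul _).mono ?_
  refine (Finset.sum_le_sum fun i _ => ?_).trans_eq (B.sum_prob hB)
  rw [mul_one, Complex.norm_real, Real.norm_of_nonneg (div_nonneg (B.h_nonneg i) hB.le)]

/-- The error of a single QDrift sample. -/
theorem exists_diamondLE_idealChannel_sub_qdriftSample (B : Hamiltonian d) (hB : 0 < B.lam)
    {s : ℝ} (hs : s ≠ 0) :
    ∃ c, 0 ≤ c ∧ c < 4 * B.lam ^ 2 * s ^ 2 ∧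
      DiamondLE (idealChannel B.op s - qdriftSample B s) c := by
  set τ : ℝ := B.lam * |s| with hτ
  have hτ0 : 0 < τ := mul_pos hB (abs_pos.2 hs)
  have hτ2 : B.lam ^ 2 * s ^ 2 = τ ^ 2 := by rw [hτ, mul_pow, sq_abs]
  set p : Fin B.L → ℝ := fun i => B.h i / B.lam with hp
  have hp0 : ∀ i, 0 ≤ p i := fun i => div_nonneg (B.h_nonneg i) hB.le
  have hp1 : ∑ i, p i = 1 := B.sum_prob hB
  set G : Matrix d d ℂ := (s : ℂ) • B.op with hG
  set F : Fin B.L → Matrix d d ℂ := fun i => ((B.lam * s : ℝ) : ℂ) • B.H i with hF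
  have hGs : IsSelfAdjoint G := isSelfAdjoint_ofReal_smul B.isHermitian_op s
  have hFs : ∀ i, IsSelfAdjoint (F i) := fun i => isSelfAdjoint_ofReal_smul (B.isHermitian i) _
  have hGn : ‖G‖ ≤ τ := by
    rw [hG, norm_smul, Complex.norm_real, Real.norm_eq_abs, hτ, mul_comm]
    exact mul_le_mul_of_nonneg_right B.norm_op_le (abs_nonneg s)
  have hFn : ∀ i, ‖F i‖ = τ := fun i => by
    rw [hF, norm_smul, B.norm_eq_one, Complex.norm_real, Real.norm_eq_abs, mul_one, abs_mul,
      abs_of_pos hB]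
  -- The QDrift probabilities are chosen for this: the mean sampled generator is the exact one.
  have hGF : ∑ i, (p i : ℂ) • F i = G := by
    rw [hG, Hamiltonian.op, Finset.smul_sum]
    refine Finset.sum_congr rfl fun i _ => ?_
    rw [hF, smul_smul, smul_smul, ← Complex.ofReal_mul, ← Complex.ofReal_mul]
    congr 2
    simp only [hp]
    field_simp
  set V := expI B.op s with hV
  set U : Fin B.L → Matrix d d ℂ := fun i => expI (B.H i) (B.lam * s) with hU
  have hVG : V = NormedSpace.exp (Complex.I • G) := expI_eq _ _
  have hUF : ∀ i, U i = NormedSpace.exp (Complex.I • F i) := fun i => expI_eq _ _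
  have hE : ‖V - 1‖ < τ := hVG ▸ norm_exp_I_smul_sub_one_lt hGs hτ0 hGn
  have hEi : ∀ i, ‖U i - 1‖ ≤ τ := fun i => by
    rw [hUF, ← hFn i]
    exact norm_exp_I_smul_sub_one_le (hFs i)
  have hR : ‖V - 1 - Complex.I • G‖ ≤ τ ^ 2 / 2 := by
    rw [hVG]
    refine (norm_exp_I_smul_sub_one_sub_le hGs).trans ?_
    gcongr
  have hRi : ∀ i, ‖U i - 1 - Complex.I • F i‖ ≤ τ ^ 2 / 2 := fun i => by
    rw [hUF, ← hFn i]
    exact norm_exp_I_smul_sub_one_sub_le (hFs i)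
  set D : Matrix d d ℂ := (V - 1) - ∑ i, (p i : ℂ) • (U i - 1) with hD
  -- By `hGF` the first-order terms cancel in `D`; the two Taylor remainders contribute `τ²/2` each.
  have hDn : ‖D‖ ≤ τ ^ 2 := by
    have e : D = (V - 1 - Complex.I • G)
        - ∑ i, (p i : ℂ) • (U i - 1 - Complex.I • F i) := by
      simp only [smul_sub (M := ℂ) (A := Matrix d d ℂ) _ _ (Complex.I • F _)]
      rw [Finset.sum_sub_distrib]
      simp only [smul_comm _ Complex.I]
      rw [← Finset.smul_sum, hGF, hD]
      abel
    rw [e]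
    have h2 : ‖∑ i, (p i : ℂ) • (U i - 1 - Complex.I • F i)‖ ≤ τ ^ 2 / 2 := by
      have h3 : ∑ i, p i * (τ ^ 2 / 2) = τ ^ 2 / 2 := by rw [← Finset.sum_mul, hp1, one_mul]
      rw [← h3]
      refine (norm_sum_le _ _).trans (Finset.sum_le_sum fun i _ => ?_)
      rw [norm_smul, Complex.norm_real, Real.norm_of_nonneg (hp0 i)]
      exact mul_le_mul_of_nonneg_left (hRi i) (hp0 i)
    refine (norm_sub_le _ _).trans ?_
    linarith
  have hdec : idealChannel B.op s - qdriftSample B s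
      = sandwich D 1 + sandwich 1 D + (sandwich (V - 1) (V - 1)
        - ∑ i, (p i : ℂ) • sandwich (U i - 1) (U i - 1)) := by
    have e1 : qdriftSample B s = ∑ i, (p i : ℂ) • conjBy (U i) := rfl
    have e2 : sandwich D 1 = sandwich (V - 1) 1
        - sandwich (∑ i, (p i : ℂ) • (U i - 1)) 1 := by
      ext1 ρ
      simp only [LinearMap.sub_apply, sandwich_apply, hD, Matrix.sub_mul]
    have e3 : sandwich 1 D = sandwich 1 (V - 1)
        - sandwich 1 (∑ i, (p i : ℂ) • (U i - 1)) := by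
      ext1 ρ
      simp only [LinearMap.sub_apply, sandwich_apply, hD, Matrix.conjTranspose_sub, Matrix.mul_sub]
    rw [e1, sum_smul_conjBy _ _ hp1, idealChannel, conjBy_eq_one_add V, e2, e3]
    abel
  have hone : ‖(1 : Matrix d d ℂ)‖ ≤ 1 := norm_le_one_of_mem_unitary (one_mem _)
  have h1 : DiamondLE (sandwich D 1) (τ ^ 2) := by
    refine (DiamondLE.sandwich D 1).mono ?_
    exact (mul_le_of_le_one_right (norm_nonneg D) hone).trans hDn
  have h2 : DiamondLE (sandwich 1 D) (τ ^ 2) := by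
    refine (DiamondLE.sandwich 1 D).mono ?_
    exact (mul_le_of_le_one_left (norm_nonneg D) hone).trans hDn
  have h3 : DiamondLE (∑ i, (p i : ℂ) • sandwich (U i - 1) (U i - 1)) (τ ^ 2) := by
    refine (DiamondLE.sum Finset.univ fun i _ => (DiamondLE.sandwich _ _).smul _).mono ?_
    have h4 : ∑ i, p i * τ ^ 2 = τ ^ 2 := by rw [← Finset.sum_mul, hp1, one_mul]
    rw [← h4]
    refine Finset.sum_le_sum fun i _ => ?_
    rw [Complex.norm_real, Real.norm_of_nonneg (hp0 i), ← sq]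
    exact mul_le_mul_of_nonneg_left (pow_le_pow_left₀ (norm_nonneg _) (hEi i) 2) (hp0 i)
  -- Two linear terms, the quadratic term of the exact evolution and the averaged quadratic term.
  -- Only the third is known to be strictly below `τ²`.
  refine ⟨τ ^ 2 + τ ^ 2 + (‖V - 1‖ * ‖V - 1‖ + τ ^ 2), by positivity, ?_, ?_⟩
  · rw [mul_assoc, hτ2]
    nlinarith [norm_nonneg (V - 1)]
  · rw [hdec]
    exact (h1.add h2).add ((DiamondLE.sandwich _ _).sub h3)

theorem DiamondLE.compositeChannel (A B : Hamiltonian d) (hB : 0 < B.lam) (N : ℕ) (s : ℝ) :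
    DiamondLE (CompositeSim.compositeChannel A B N s) 1 := by
  have h := ((DiamondLE.qdriftSample B hB (s / N)).pow N).mul zero_le_one
    (DiamondLE.conjBy (norm_trotter_prod_le_one A.h A.isHermitian s))
  rwa [one_mul] at h

/-- The error of one step of the first-order composite channel. -/
theorem exists_diamondLE_idealChannel_sub_compositeChannel (A B : Hamiltonian d)
    (hB : 0 < B.lam) {N : ℕ} (hN : 1 ≤ N) {s : ℝ} (hs : s ≠ 0) :
    ∃ c, 0 ≤ c ∧ c < s ^ 2 * ((∑ i, ∑ j, A.h i * A.h j * ‖A.H i * A.H j - A.H j * A.H i‖)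
        + (∑ i, ∑ j, A.h i * B.h j * ‖A.H i * B.H j - B.H j * A.H i‖) + 4 * B.lam ^ 2 / N) ∧
      DiamondLE (idealChannel (A.op + B.op) s - compositeChannel A B N s) c := by
  have hN0 : (0 : ℝ) < N := by exact_mod_cast hN
  obtain ⟨c, hc0, hc, hd⟩ := exists_diamondLE_idealChannel_sub_qdriftSample B hB
    (div_ne_zero hs hN0.ne')
  have hS := norm_trotter_prod_le_one A.h A.isHermitian s
  have h1 := DiamondLE.conjBy_sub_conjBy
    (norm_expI_le_one (A.isHermitian_op.add B.isHermitian_op) s)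
    ((norm_mul_le (expI B.op s) (trotterUnitary A s)).trans
      (mul_le_one₀ (norm_expI_le_one B.isHermitian_op s) (norm_nonneg _) hS))
  have h2 := (DiamondLE.conjBy (norm_expI_le_one B.isHermitian_op (s / N))).pow_sub_pow
    (DiamondLE.qdriftSample B hB (s / N)) hc0 hd N
  have h3 := h2.mul (by positivity) (DiamondLE.conjBy hS)
  -- The hybrid channel, exact in `B` but Trotterized in `A`, separates the operator error from the
  -- sampling error.
  have e : idealChannel (A.op + B.op) s - compositeChannel A B N s
      = (conjBy (expI (A.op + B.op) s) - conjBy (expI B.op s * trotterUnitary A s))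
        + (conjBy (expI B.op (s / N)) ^ N - qdriftSample B (s / N) ^ N)
          * conjBy (trotterUnitary A s) := by
    have e1 : compositeChannel A B N s
        = qdriftSample B (s / N) ^ N * conjBy (trotterUnitary A s) := rfl
    have e2 : expI B.op s = expI B.op (s / N) ^ N := by
      rw [← expI_nat_mul, mul_div_cancel₀ _ hN0.ne']
    rw [e1, sub_mul, idealChannel, conjBy_mul, e2, conjBy_pow]
    abel
  refine ⟨_, ?_, ?_, e ▸ h1.add h3⟩
  · positivity
  · have h4 := norm_expI_op_add_sub_trotterUnitary_le A B s
    have h5 : N * c < s ^ 2 * (4 * B.lam ^ 2 / N) := by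
      calc N * c < N * (4 * B.lam ^ 2 * (s / N) ^ 2) := by gcongr
        _ = s ^ 2 * (4 * B.lam ^ 2 / N) := by field_simp
    rw [mul_one]
    linarith

end Bounds

/-! ### Randomized circuits and gate counts -/

section Circuits

variable {d : Type*} [Fintype d] [DecidableEq d] {κ : Type}

/-- `Φ` is implemented by a randomized sequence of exactly `m` exponential gates. -/
def Implementable (K : κ → Matrix d d ℂ) (m : ℕ) (Φ : SuperOp d) : Prop :=
  ∃ C : RandomCircuit κ, C.channel K = Φ ∧ ∀ k, (C.gates k).length = m

theorem Implementable.of_sum (K : κ → Matrix d d ℂ) {ι : Type*} [Fintype ι] (p : ι → ℝ)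
    (hp : ∀ i, 0 ≤ p i) (hp1 : ∑ i, p i = 1) (g : ι → List (κ × ℝ)) {m : ℕ}
    (hg : ∀ i, (g i).length = m) :
    Implementable K m (∑ i, (p i : ℂ) • conjBy (gateProduct K (g i))) := by
  refine ⟨⟨Fintype.card ι, fun k => p ((Fintype.equivFin ι).symm k),
    fun k => g ((Fintype.equivFin ι).symm k), fun k => hp _, ?_⟩, ?_, fun k => hg _⟩
  · rw [← hp1]
    exact (Fintype.equivFin ι).symm.sum_comp p
  · exact (Fintype.equivFin ι).symm.sum_comp
      fun i => (p i : ℂ) • conjBy (gateProduct K (g i))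

theorem gateProduct_append (K : κ → Matrix d d ℂ) (l l' : List (κ × ℝ)) :
    gateProduct K (l ++ l') = gateProduct K l * gateProduct K l' := by
  rw [gateProduct, List.map_append, List.prod_append]
  rfl

theorem Implementable.conjBy (K : κ → Matrix d d ℂ) (l : List (κ × ℝ)) :
    Implementable K l.length (CompositeSim.conjBy (gateProduct K l)) := by
  simpa using Implementable.of_sum K (fun _ : Unit => 1) (fun _ => zero_le_one) (by simp)
    (fun _ => l) (fun _ => rfl)

/-- Run the two circuits independently: probabilities multiply and gate lists concatenate. -/
theorem Implementable.mul {K : κ → Matrix d d ℂ} {m m' : ℕ} {Φ Ψ : SuperOp d}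
    (h : Implementable K m Φ) (h' : Implementable K m' Ψ) :
    Implementable K (m + m') (Φ * Ψ) := by
  obtain ⟨C, rfl, hC⟩ := h
  obtain ⟨C', rfl, hC'⟩ := h'
  have e : C.channel K * C'.channel K = ∑ x : Fin C.m × Fin C'.m,
      ((C.prob x.1 * C'.prob x.2 : ℝ) : ℂ)
        • CompositeSim.conjBy (gateProduct K (C.gates x.1 ++ C'.gates x.2)) := by
    rw [RandomCircuit.channel, RandomCircuit.channel, Finset.sum_mul_sum, Fintype.sum_prod_type]
    refine Finset.sum_congr rfl fun i _ => Finset.sum_congr rfl fun j _ => ?_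
    rw [gateProduct_append, conjBy_mul, smul_mul_smul_comm, Complex.ofReal_mul]
  rw [e]
  refine Implementable.of_sum K _ (fun x => mul_nonneg (C.prob_nonneg _) (C'.prob_nonneg _)) ?_ _
    fun x => by rw [List.length_append, hC, hC']
  rw [Fintype.sum_prod_type, ← Finset.sum_mul_sum, C.sum_prob, C'.sum_prob, one_mul]

theorem Implementable.pow {K : κ → Matrix d d ℂ} {m : ℕ} {Φ : SuperOp d}
    (h : Implementable K m Φ) (r : ℕ) : Implementable K (m * r) (Φ ^ r) := by
  induction r with
  | zero =>
    have := Implementable.conjBy K []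
    rwa [gateProduct, List.map_nil, List.prod_nil, conjBy_one] at this
  | succ r ih =>
    rw [pow_succ]
    exact ih.mul h

theorem Implementable.trotterChannel (A B : Hamiltonian d) (s : ℝ) :
    Implementable (Sum.elim A.H B.H) A.L (CompositeSim.trotterChannel A s) := by
  have h := Implementable.conjBy (Sum.elim A.H B.H)
    (List.ofFn fun i : Fin A.L => ((Sum.inl i : Fin A.L ⊕ Fin B.L), A.h i * s)).reverse
  rw [List.length_reverse, List.length_ofFn, gateProduct, List.map_reverse, List.map_ofFn] at h
  exact h

theorem Implementable.qdriftSample (A B : Hamiltonian d) (hB : 0 < B.lam) (s : ℝ) :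
    Implementable (Sum.elim A.H B.H) 1 (CompositeSim.qdriftSample B s) := by
  have h := Implementable.of_sum (Sum.elim A.H B.H) (fun i => B.h i / B.lam)
    (fun i => div_nonneg (B.h_nonneg i) hB.le) (B.sum_prob hB)
    (fun i : Fin B.L => [((Sum.inr i : Fin A.L ⊕ Fin B.L), B.lam * s)]) (fun _ => rfl)
  simp only [gateProduct, List.map_cons, List.map_nil, List.prod_singleton, Sum.elim_inr] at h
  exact h

theorem Implementable.compositeChannel (A B : Hamiltonian d) (hB : 0 < B.lam) (N : ℕ) (s : ℝ) :
    Implementable (Sum.elim A.H B.H) (A.L + N) (CompositeSim.compositeChannel A B N s) := by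
  have h := ((Implementable.qdriftSample A B hB (s / N)).pow N).mul
    (Implementable.trotterChannel A B s)
  rwa [one_mul, add_comm] at h

end Circuits

/-! ### Assembly of the error bound and the gate count -/

/-- The diamond-norm error of `r` steps of the first-order composite channel. -/
theorem diamondNorm_idealChannel_sub_compositeChannel_pow_lt {d : Type*} [Fintype d]
    [DecidableEq d] (A B : Hamiltonian d) (hB : 0 < B.lam) {N : ℕ} (hN : 1 ≤ N) {t ε : ℝ}
    (hε : 0 < ε) {r : ℕ}
    (hr : r = ⌈t ^ 2 / ε *
      ((∑ i, ∑ j, A.h i * A.h j * ‖A.H i * A.H j - A.H j * A.H i‖)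
        + (∑ i, ∑ j, A.h i * B.h j * ‖A.H i * B.H j - B.H j * A.H i‖)
        + 4 * B.lam ^ 2 / N)⌉₊) :
    diamondNorm (idealChannel (A.op + B.op) t - compositeChannel A B N (t / r) ^ r)
      < ENNReal.ofReal ε := by
  have hN0 : (0 : ℝ) < N := by exact_mod_cast hN
  set Γ : ℝ := (∑ i, ∑ j, A.h i * A.h j * ‖A.H i * A.H j - A.H j * A.H i‖)
        + (∑ i, ∑ j, A.h i * B.h j * ‖A.H i * B.H j - B.H j * A.H i‖)
        + 4 * B.lam ^ 2 / N with hΓ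
  -- Positivity comes from `λ_B > 0`; it forces `r ≥ 1` when `t ≠ 0`.
  have hΓ0 : 0 < Γ := by
    have h1 : 0 ≤ ∑ i, ∑ j, A.h i * A.h j * ‖A.H i * A.H j - A.H j * A.H i‖ :=
      Finset.sum_nonneg fun i _ => Finset.sum_nonneg fun j _ =>
        mul_nonneg (mul_nonneg (A.h_nonneg i) (A.h_nonneg j)) (norm_nonneg _)
    have h2 : 0 ≤ ∑ i, ∑ j, A.h i * B.h j * ‖A.H i * B.H j - B.H j * A.H i‖ :=
      Finset.sum_nonneg fun i _ => Finset.sum_nonneg fun j _ =>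
        mul_nonneg (mul_nonneg (A.h_nonneg i) (B.h_nonneg j)) (norm_nonneg _)
    positivity
  suffices h : ∃ c, 0 ≤ c ∧ c < ε ∧
      DiamondLE (idealChannel (A.op + B.op) t - compositeChannel A B N (t / r) ^ r) c by
    obtain ⟨c, hc0, hc, hd⟩ := h
    exact (hd.diamondNorm_le hc0).trans_lt ((ENNReal.ofReal_lt_ofReal_iff hε).2 hc)
  -- At `t = 0` the one-step strict bound is unavailable, but `r = 0` and both channels are the
  -- identity.
  rcases eq_or_ne t 0 with rfl | ht
  · have hr0 : r = 0 := by rw [hr]; simp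
    refine ⟨0, le_rfl, hε, ?_⟩
    rw [hr0, pow_zero, idealChannel, expI_zero, conjBy_one, sub_self]
    exact DiamondLE.zero
  · have hpos : 0 < t ^ 2 / ε * Γ := by positivity
    have hrpos : 0 < r := by rw [hr]; exact Nat.ceil_pos.2 hpos
    have hr0 : (0 : ℝ) < r := by exact_mod_cast hrpos
    have hle : t ^ 2 / ε * Γ ≤ r := by rw [hr]; exact Nat.le_ceil _
    obtain ⟨c, hc0, hc, hd⟩ := exists_diamondLE_idealChannel_sub_compositeChannel A B hB hN
      (div_ne_zero ht hr0.ne')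
    refine ⟨r * c, by positivity, ?_, ?_⟩
    · calc r * c < r * ((t / r) ^ 2 * Γ) := by gcongr
        _ = t ^ 2 * Γ / r := by field_simp
        _ ≤ ε := by
          rw [div_le_iff₀ hr0]
          calc t ^ 2 * Γ = ε * (t ^ 2 / ε * Γ) := by field_simp
            _ ≤ ε * r := by gcongr
    · have h := (DiamondLE.conjBy (norm_expI_le_one (A.isHermitian_op.add B.isHermitian_op)
        (t / r))).pow_sub_pow (DiamondLE.compositeChannel A B hB N (t / r)) hc0 hd r
      rwa [← conjBy_pow, ← expI_nat_mul, mul_div_cancel₀ _ hr0.ne'] at h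

end CompositeSim

end

theorem mainTheorem4 {d : Type*} [Fintype d] [DecidableEq d]
    (A B : CompositeSim.Hamiltonian d) (hB : 0 < B.lam)
    (N_B : ℕ) (hN : 1 ≤ N_B) (t ε : ℝ) (hε : 0 < ε)
    (r : ℕ)
    (hr : r = ⌈t ^ 2 / ε *
      ((∑ i, ∑ j, A.h i * A.h j * ‖A.H i * A.H j - A.H j * A.H i‖)
        + (∑ i, ∑ j, A.h i * B.h j * ‖A.H i * B.H j - B.H j * A.H i‖)
        + 4 * B.lam ^ 2 / N_B)⌉₊) :
    CompositeSim.diamondNorm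
        (CompositeSim.idealChannel (A.op + B.op) t
          - CompositeSim.compositeChannel A B N_B (t / r) ^ r) < ENNReal.ofReal ε ∧
      ∃ C : CompositeSim.RandomCircuit (Fin A.L ⊕ Fin B.L),
        C.channel (Sum.elim A.H B.H) = CompositeSim.compositeChannel A B N_B (t / r) ^ r ∧
        ∀ k, (C.gates k).length = (A.L + N_B) * r := by
  exact ⟨CompositeSim.diamondNorm_idealChannel_sub_compositeChannel_pow_lt A B hB hN hε hr,
    (CompositeSim.Implementable.compositeChannel A B hB N_B (t / r)).pow r⟩
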